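/- Let $n$ be a natural number and let $\mathfrak L_n$ be the set of Laplacian matrices of connected, undirected, simple graphs on $n$ nodes with positive link weights. For $L\in\mathfrak L_n$ with eigenvalues $0=\lambda_1<\lambda_2\le\dots\le\lambda_n$, consider the consensus network $\dot x=-Lx+\xi$, $y=M_nx$, where $M_n=I_n-\frac1nJ_n$ and $J_n$ is the all-ones matrix. Let $G(s)=M_n(sI_n+L)^{-1}$ be its transfer matrix from $\xi$ to $y$, and let $\sigma_1\ge\dots\ge\sigma_n$ denote singular values. Define $$\|G\|_{\mathcal H_p}=\Big\{\frac1{2\pi}\int_{-\infty}^{\infty}\sum_{k=1}^n\sigma_k(G(j\omega))^p\,d\omega\Big\}^{1/p}\ (1<p<\infty),\qquad \|G\|_{\mathcal H_\infty}=\operatorname*{ess\,sup}_{\omega\in\mathbb R}\sigma_1(G(j\omega)),$$ $$\zeta_q(L)=\Big(\sum_{i=2}^n\lambda_i^{-q}\Big)^{1/q}\ (1\le q<\infty),\qquad \zeta_\infty(L)=\max_{2\le i\le n}\lambda_i^{-1}$$ (the maximum of the empty set being $0$), and $\alpha_0=\alpha_0(p)$ by $\alpha_0(p)^{-1}=\big(-\beta(\tfrac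 p2,-\tfrac12)\big)^{1/p}$ for $p<\infty$, $\alpha_0(\infty)=1$, where $\beta(x,y)=\Gamma(x)\Gamma(y)/\Gamma(x+y)$. A function $\rho:\mathfrak L_n\to\mathbb R$ is called a systemic performance measure if it is monotone ($L_2\preceq L_1$ in the positive semidefinite order implies $\rho(L_1)\le\rho(L_2)$), convex on the set $\mathfrak L_n$ (which is convex), and orthogonally invariant ($\rho(ULU^{\mathsf T})=\rho(L)$ whenever $U$ is orthogonal and $L,ULU^{\mathsf T}\in\mathfrak L_n$). Theorem. Let $2\le p\le\infty$. Then $\|G\|_{\mathcal H_p}$ is finite and, as a function of $L\in\mathfrak L_n$, is a systemic performance measure. Moreover, for every $L\in\mathfrak L_n$, $$\|G\|_{\mathcal H_p}=\alpha_0(p)\,\zeta_{p-1}(L)^{\,1-\frac1p},$$ where for $p=\infty$ the subscript $p-1$ is $\infty$ and the exponent $1-\frac1p$ is $1$. The values at $\infty$ are limits: as $r\to\infty$, $\alpha_0(r)\to\alpha_0(\infty)$, and $\zeta_r(L)\to\zeta_\infty(L)$ and $\|G\|_{\mathcal H_r}\to\|G\|_{\mathcal H_\infty}$ for every $L\in\mathfrak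 L_n$. -/

import Mathlib

open MeasureTheory Filter Topology
open scoped ENNReal Matrix

namespace ConsensusNetwork

noncomputable section

/-- The coupling graph of a gain matrix `K`: `{i, j}` is a link iff `i ≠ j` and the gain between
`i` and `j` does not vanish. -/
def couplingGraph {n : ℕ} (K : Matrix (Fin n) (Fin n) ℝ) : SimpleGraph (Fin n) :=
  SimpleGraph.fromRel fun i j => K i j ≠ 0

/-- Feedback gains of a linear consensus network: nonnegative, symmetric, without self-loops, and
with a connected coupling graph. -/
structure IsFeedbackGain {n : ℕ} (K : Matrix (Fin n) (Fin n) ℝ) : Prop where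
  nonneg : ∀ i j, 0 ≤ K i j
  symm : ∀ i j, K i j = K j i
  simple : ∀ i, K i i = 0
  connected : (couplingGraph K).Connected

/-- The Laplacian matrix `Δ - A` of a weighted graph with adjacency matrix `K`. -/
def laplacian {n : ℕ} (K : Matrix (Fin n) (Fin n) ℝ) : Matrix (Fin n) (Fin n) ℝ :=
  Matrix.diagonal (fun i => ∑ j, K i j) - K

/-- The set of Laplacian matrices of all connected weighted graphs with `n` nodes. -/
def laplacians (n : ℕ) : Set (Matrix (Fin n) (Fin n) ℝ) :=
  {L | ∃ K, IsFeedbackGain K ∧ L = laplacian K}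

theorem isHermitian_of_mem_laplacians {n : ℕ} {L : Matrix (Fin n) (Fin n) ℝ}
    (hL : L ∈ laplacians n) : L.IsHermitian := by
  obtain ⟨K, hK, rfl⟩ := hL
  refine (Matrix.isHermitian_diagonal _).sub ?_
  ext i j
  simpa using hK.symm j i

/-- A systemic performance measure: an operator on the Laplacian matrices of connected weighted
graphs with `n` nodes (only the values of `ρ` on `laplacians n` matter) that is monotone with
respect to the positive semidefinite order, convex, and orthogonally invariant. -/
structure IsSystemicPerformanceMeasure {n : ℕ} (ρ : Matrix (Fin n) (Fin n) ℝ → ℝ) : Prop where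
  monotone : ∀ L₁ ∈ laplacians n, ∀ L₂ ∈ laplacians n, (L₁ - L₂).PosSemidef → ρ L₁ ≤ ρ L₂
  convex : ConvexOn ℝ (laplacians n) ρ
  orthogonal_invariant : ∀ L ∈ laplacians n, ∀ U ∈ Matrix.orthogonalGroup (Fin n) ℝ,
    U * L * Uᵀ ∈ laplacians n → ρ L = ρ (U * L * Uᵀ)

/-- The eigenvalues of a symmetric matrix in ascending order, repeated according to multiplicity;
index `0` is the smallest one. (Mathlib's `eigenvalues₀` is in descending order.) -/
def eigenvalue {n : ℕ} {L : Matrix (Fin n) (Fin n) ℝ} (hL : L.IsHermitian) (i : Fin n) : ℝ :=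
  hL.eigenvalues₀ (Fin.cast (Fintype.card_fin n).symm i.rev)

/-- The spectral zeta function of order `q`: `(∑ λ_i ^ (-q)) ^ (1 / q)`, the sum being over all the
eigenvalues except the smallest one; for `q = ∞` it is the largest of the numbers `λ_i⁻¹`. -/
def spectralZeta {n : ℕ} {L : Matrix (Fin n) (Fin n) ℝ} (hL : L.IsHermitian) (q : ℝ≥0∞) : ℝ :=
  if q = ∞ then ⨆ i : {i : Fin n // 0 < (i : ℕ)}, (eigenvalue hL i)⁻¹
  else (∑ i : {i : Fin n // 0 < (i : ℕ)}, eigenvalue hL i ^ (-q.toReal)) ^ (1 / q.toReal)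

/-- The centering matrix `I - J / n`. -/
def centering (n : ℕ) : Matrix (Fin n) (Fin n) ℝ :=
  1 - (1 / (n : ℝ)) • Matrix.of fun _ _ => 1

/-- The transfer matrix `s ↦ C (s I - A)⁻¹ B` of the system `x' = A x + B ξ`, `y = C x`. -/
def transferMatrix {n : ℕ} (A B C : Matrix (Fin n) (Fin n) ℝ) (s : ℂ) :
    Matrix (Fin n) (Fin n) ℂ :=
  C.map Complex.ofReal * (s • 1 - A.map Complex.ofReal)⁻¹ * B.map Complex.ofReal

/-- The `k`-th singular value of a square complex matrix, in descending order; index `0` is the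
largest one. -/
def singularValue {n : ℕ} (G : Matrix (Fin n) (Fin n) ℂ) (k : ℕ) : ℝ :=
  (Matrix.toEuclideanLin G).singularValues k

/-- The `p`-Hardy-Schatten norm of a transfer matrix, with values in `[0, ∞]`:
`((1 / 2π) ∫ ∑ₖ σₖ(G(jω)) ^ p dω) ^ (1 / p)`, and for `p = ∞` the usual `H_∞`-norm, the essential
supremum of the largest singular value of `G(jω)`. -/
def hardySchattenNorm {n : ℕ} (p : ℝ≥0∞) (G : ℂ → Matrix (Fin n) (Fin n) ℂ) : ℝ≥0∞ :=
  if p = ∞ then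
    essSup (fun ω : ℝ => ENNReal.ofReal (singularValue (G (Complex.I * ω)) 0)) volume
  else
    (ENNReal.ofReal (1 / (2 * Real.pi)) * ∫⁻ ω : ℝ, ∑ k : Fin n,
      ENNReal.ofReal (singularValue (G (Complex.I * ω)) k ^ p.toReal)) ^ (1 / p.toReal)

/-- The `p`-Hardy-Schatten norm of the consensus network `x' = -L x + ξ`, `y = Mₙ x`. -/
def networkNorm {n : ℕ} (p : ℝ≥0∞) (L : Matrix (Fin n) (Fin n) ℝ) : ℝ≥0∞ :=
  hardySchattenNorm p (transferMatrix (-L) 1 (centering n))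

/-- The constant `α₀` with `α₀⁻¹ = (-β(p/2, -1/2)) ^ (1/p)`, and `α₀ = 1` for `p = ∞`, which is the
limit. Here `ProbabilityTheory.beta a b` is `Γ(a) Γ(b) / Γ(a + b)`, for all real `a` and `b`. -/
def alphaZero (p : ℝ≥0∞) : ℝ :=
  if p = ∞ then 1
  else ((-ProbabilityTheory.beta (p.toReal / 2) (-1 / 2)) ^ (1 / p.toReal))⁻¹

end

end ConsensusNetwork

/-! The kernel of a connected Laplacian `L` is spanned by the all-ones vector, and `centering n` is
the orthogonal projection off that kernel. Hence one orthogonal matrix diagonalizes both, and for `ω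
≠ 0` the matrix `G(jω)` is normal with eigenvalues `0` and `(jω + λ_i)⁻¹`; its singular values are
`0` and `(λ_i² + ω²)^(-1/2)`. Since `∫ (a² + ω²)^(-p/2) dω` is a constant times `a^(-(p-1))`, the
norm is `α₀ (∑ λ_i^(-(p-1)))^(1/p)` for finite `p`.

Monotonicity and convexity rest on Peierls' inequality (`IsDiagonalization.sum_diag_rpow_neg_le`):
passing from the eigenvalues of `L` to its diagonal entries in the eigenbasis of another Laplacian
does not increase the sum of `-q`-th powers. This reduces matrix statements to statements about
positive vectors, where `(∑ x_i^(-q))^t` is decreasing and log-convex. Orthogonal invariance holds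
because the spectrum determines the norm.

For `p = ∞` the norm is computed directly as `max λ_i⁻¹`. This is the limit of the finite-order
norms, so it inherits the three properties from them. -/

namespace ConsensusNetwork

/-! ### Quadratic form of a Laplacian; convexity of the set of Laplacians. -/

section Laplacian

variable {n : ℕ}

theorem laplacian_mulVec_apply (K : Matrix (Fin n) (Fin n) ℝ) (x : Fin n → ℝ) (i : Fin n) :
    (laplacian K *ᵥ x) i = ∑ j, K i j * (x i - x j) := by
  rw [laplacian, Matrix.sub_mulVec, Pi.sub_apply, Matrix.mulVec_diagonal, Finset.sum_mul,
    Matrix.mulVec, dotProduct, ← Finset.sum_sub_distrib]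
  exact Finset.sum_congr rfl fun j _ => by ring

theorem laplacian_mulVec_one (K : Matrix (Fin n) (Fin n) ℝ) : laplacian K *ᵥ 1 = 0 := by
  ext i
  simp [laplacian_mulVec_apply]

theorem dotProduct_laplacian_mulVec {K : Matrix (Fin n) (Fin n) ℝ} (hK : ∀ i j, K i j = K j i)
    (x : Fin n → ℝ) :
    2 * (x ⬝ᵥ laplacian K *ᵥ x) = ∑ i, ∑ j, K i j * (x i - x j) ^ 2 := by
  have h1 : x ⬝ᵥ laplacian K *ᵥ x = ∑ i, ∑ j, K i j * (x i * (x i - x j)) := by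
    simp only [dotProduct, laplacian_mulVec_apply, Finset.mul_sum]
    exact Finset.sum_congr rfl fun i _ => Finset.sum_congr rfl fun j _ => by ring
  have h2 : x ⬝ᵥ laplacian K *ᵥ x = ∑ i, ∑ j, K i j * (x j * (x j - x i)) := by
    rw [h1, Finset.sum_comm]
    exact Finset.sum_congr rfl fun i _ => Finset.sum_congr rfl fun j _ => by rw [hK]
  rw [two_mul]
  nth_rw 1 [h1]
  rw [h2]
  simp only [← Finset.sum_add_distrib]
  exact Finset.sum_congr rfl fun i _ => Finset.sum_congr rfl fun j _ => by ring

theorem dotProduct_laplacian_mulVec_nonneg {K : Matrix (Fin n) (Fin n) ℝ} (hK : IsFeedbackGain K)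
    (x : Fin n → ℝ) : 0 ≤ x ⬝ᵥ laplacian K *ᵥ x := by
  have h := dotProduct_laplacian_mulVec hK.symm x
  have : 0 ≤ ∑ i, ∑ j, K i j * (x i - x j) ^ 2 :=
    Finset.sum_nonneg fun i _ => Finset.sum_nonneg fun j _ =>
      mul_nonneg (hK.nonneg i j) (sq_nonneg _)
  linarith

theorem eq_of_dotProduct_laplacian_mulVec_eq_zero {K : Matrix (Fin n) (Fin n) ℝ}
    (hK : IsFeedbackGain K) {x : Fin n → ℝ} (hx : x ⬝ᵥ laplacian K *ᵥ x = 0) (i j : Fin n) :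
    x i = x j := by
  have h := dotProduct_laplacian_mulVec hK.symm x
  rw [hx, mul_zero, eq_comm] at h
  have hnn : ∀ i j, 0 ≤ K i j * (x i - x j) ^ 2 := fun i j =>
    mul_nonneg (hK.nonneg i j) (sq_nonneg _)
  have hz : ∀ i j, K i j * (x i - x j) ^ 2 = 0 := fun i j =>
    (Finset.sum_eq_zero_iff_of_nonneg fun j _ => hnn i j).1
      ((Finset.sum_eq_zero_iff_of_nonneg fun i _ => Finset.sum_nonneg fun j _ => hnn i j).1 h i
        (Finset.mem_univ _)) j (Finset.mem_univ _)
  have hadj : ∀ i j, (couplingGraph K).Adj i j → x i = x j := by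
    intro i j hij
    rw [couplingGraph, SimpleGraph.fromRel_adj] at hij
    have hKij : K i j ≠ 0 := hij.2.elim id fun h => by rwa [hK.symm]
    have := (mul_eq_zero.1 (hz i j)).resolve_left hKij
    exact sub_eq_zero.1 (pow_eq_zero_iff two_ne_zero |>.1 this)
  obtain ⟨p⟩ := hK.connected.preconnected i j
  induction p with
  | nil => rfl
  | cons h _ ih => exact (hadj _ _ h).trans ih

theorem laplacian_combination (K₁ K₂ : Matrix (Fin n) (Fin n) ℝ) (a b : ℝ) :
    a • laplacian K₁ + b • laplacian K₂ = laplacian (a • K₁ + b • K₂) := by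
  ext i j
  by_cases hij : i = j
  · subst hij
    simp [laplacian, Finset.sum_add_distrib, ← Finset.mul_sum]
    ring
  · simp [laplacian, hij]
    ring

theorem IsFeedbackGain.combination {K₁ K₂ : Matrix (Fin n) (Fin n) ℝ} (h₁ : IsFeedbackGain K₁)
    (h₂ : IsFeedbackGain K₂) {a b : ℝ} (ha : 0 < a) (hb : 0 ≤ b) :
    IsFeedbackGain (a • K₁ + b • K₂) where
  nonneg i j := add_nonneg (mul_nonneg ha.le (h₁.nonneg i j)) (mul_nonneg hb (h₂.nonneg i j))
  symm i j := by simp [h₁.symm i j, h₂.symm i j]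
  simple i := by simp [h₁.simple i, h₂.simple i]
  connected := by
    refine h₁.connected.mono fun i j hij => ?_
    rw [couplingGraph, SimpleGraph.fromRel_adj] at hij ⊢
    have key : ∀ i j, K₁ i j ≠ 0 → (a • K₁ + b • K₂) i j ≠ 0 := fun i j h =>
      (add_pos_of_pos_of_nonneg (mul_pos ha ((h₁.nonneg i j).lt_of_ne' h))
        (mul_nonneg hb (h₂.nonneg i j))).ne'
    exact ⟨hij.1, hij.2.imp (key i j) (key j i)⟩

theorem convex_laplacians : Convex ℝ (laplacians n) := by
  rintro _ ⟨K₁, h₁, rfl⟩ _ ⟨K₂, h₂, rfl⟩ a b ha hb hab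
  refine ⟨a • K₁ + b • K₂, ?_, laplacian_combination K₁ K₂ a b⟩
  -- A positive weight is needed to keep the links of one of the two graphs, and with them
  -- connectedness; if `a = 0` then `b = 1`.
  rcases ha.lt_or_eq with ha' | rfl
  · exact h₁.combination h₂ ha' hb
  · rw [add_comm]
    exact h₂.combination h₁ (by linarith) le_rfl

end Laplacian

/-! ### Simultaneous diagonalization of a Laplacian and the centering matrix. -/

section Diagonalization

variable {n : ℕ}

theorem exists_eigenvalue_diagonalization {L : Matrix (Fin n) (Fin n) ℝ} (hL : L.IsHermitian) :
    ∃ V : Matrix (Fin n) (Fin n) ℝ, Vᵀ * V = 1 ∧ V * Vᵀ = 1 ∧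
      L = V * Matrix.diagonal (eigenvalue hL) * Vᵀ := by
  -- The permutation matching the ascending order of `eigenvalue` with the indexing of
  -- `eigenvalues`; the columns of the eigenvector matrix are permuted by it.
  let e : Fin n ≃ Fin n := (Fin.revPerm.trans (finCongr (Fintype.card_fin n).symm)).trans
    (Fintype.equivOfCardEq (Fintype.card_fin _))
  have he : eigenvalue hL = hL.eigenvalues ∘ e := by
    ext i
    simp [eigenvalue, Matrix.IsHermitian.eigenvalues, e]
  let U : Matrix (Fin n) (Fin n) ℝ := hL.eigenvectorUnitary
  have hU₁ : Uᵀ * U = 1 := by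
    have := Unitary.coe_star_mul_self hL.eigenvectorUnitary
    rwa [Matrix.star_eq_conjTranspose, Matrix.conjTranspose_eq_transpose_of_trivial] at this
  have hU₂ : U * Uᵀ = 1 := mul_eq_one_comm.1 hU₁
  refine ⟨U.submatrix id e, ?_, ?_, ?_⟩
  · rw [Matrix.transpose_submatrix, Matrix.submatrix_mul _ _ _ _ _ Function.bijective_id |>.symm,
      hU₁, Matrix.submatrix_one_equiv]
  · rw [Matrix.transpose_submatrix, Matrix.submatrix_mul_equiv, hU₂, Matrix.submatrix_id_id]
  · have h := hL.spectral_theorem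
    rw [Unitary.conjStarAlgAut_apply, Matrix.star_eq_conjTranspose,
      Matrix.conjTranspose_eq_transpose_of_trivial] at h
    have hd : Matrix.diagonal (eigenvalue hL) =
        (Matrix.diagonal (RCLike.ofReal ∘ hL.eigenvalues)).submatrix e e := by
      rw [Matrix.submatrix_diagonal_equiv, he]
      rfl
    rw [hd, Matrix.transpose_submatrix, Matrix.submatrix_mul_equiv, Matrix.submatrix_mul_equiv,
      Matrix.submatrix_id_id]
    exact h

theorem eigenvalue_mono {L : Matrix (Fin n) (Fin n) ℝ} (hL : L.IsHermitian) :
    Monotone (eigenvalue hL) := fun i j hij =>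
  hL.eigenvalues₀_antitone (by simpa using Fin.rev_le_rev.2 hij)

theorem eigenvalue_eq_of_charpoly_eq {A B : Matrix (Fin n) (Fin n) ℝ} (hA : A.IsHermitian)
    (hB : B.IsHermitian) (h : A.charpoly = B.charpoly) : eigenvalue hA = eigenvalue hB := by
  have : hA.eigenvalues₀ = hB.eigenvalues₀ := by
    simp_rw [← List.ofFn_inj, ← Matrix.IsHermitian.sort_roots_charpoly_eq_eigenvalues₀, h]
  ext i
  simp [eigenvalue, this]

/-- An orthogonal diagonalization of the Laplacian matrix `L` with eigenvalues `d`, the first of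
which is the simple eigenvalue `0`. -/
structure IsDiagonalization (L V : Matrix (Fin n) (Fin n) ℝ) (d : Fin n → ℝ) : Prop where
  transpose_mul : Vᵀ * V = 1
  mul_transpose : V * Vᵀ = 1
  eq : L = V * Matrix.diagonal d * Vᵀ
  zero : ∀ i : Fin n, (i : ℕ) = 0 → d i = 0
  pos : ∀ i : Fin n, 0 < (i : ℕ) → 0 < d i
  centering_eq : centering n =
    V * Matrix.diagonal (fun i : Fin n => if (i : ℕ) = 0 then (0 : ℝ) else 1) * Vᵀ

theorem exists_isDiagonalization {L : Matrix (Fin n) (Fin n) ℝ} (hL : L ∈ laplacians n) :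
    ∃ V, IsDiagonalization L V (eigenvalue (isHermitian_of_mem_laplacians hL)) := by
  obtain ⟨V, hV₁, hV₂, hLV⟩ := exists_eigenvalue_diagonalization (isHermitian_of_mem_laplacians hL)
  set d := eigenvalue (isHermitian_of_mem_laplacians hL) with hd
  have hmono : Monotone d := eigenvalue_mono _
  clear_value d
  obtain ⟨K, hK, rfl⟩ := hL
  have hn : 0 < n := Fin.pos_iff_nonempty.2 hK.connected.nonempty
  have hdiag : Vᵀ * laplacian K * V = Matrix.diagonal d := by
    rw [hLV]
    calc Vᵀ * (V * Matrix.diagonal d * Vᵀ) * V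
        = (Vᵀ * V) * Matrix.diagonal d * (Vᵀ * V) := by simp only [Matrix.mul_assoc]
      _ = _ := by rw [hV₁, Matrix.one_mul, Matrix.mul_one]
  have hquad : ∀ i, (fun k => V k i) ⬝ᵥ laplacian K *ᵥ (fun k => V k i) = d i := by
    intro i
    have := congrFun (congrFun hdiag i) i
    rw [Matrix.diagonal_apply_eq, Matrix.mul_assoc] at this
    exact this
  have hnonneg : ∀ i, 0 ≤ d i := fun i =>
    (hquad i).symm ▸ dotProduct_laplacian_mulVec_nonneg hK _
  -- Coordinates of the all-ones vector in the eigenbasis. As this vector is in the kernel, `w`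
  -- lives only where `d` vanishes.
  set w : Fin n → ℝ := Vᵀ *ᵥ 1 with hw
  have hVw : V *ᵥ w = 1 := by rw [hw, Matrix.mulVec_mulVec, hV₂, Matrix.one_mulVec]
  have hdw : ∀ i, d i * w i = 0 := by
    have : Matrix.diagonal d *ᵥ w = 0 := by
      rw [← hdiag, ← Matrix.mulVec_mulVec, hVw, ← Matrix.mulVec_mulVec, laplacian_mulVec_one,
        Matrix.mulVec_zero]
    intro i
    simpa [Matrix.mulVec_diagonal] using congrFun this i
  have hw0 : ∃ i, w i ≠ 0 := by
    by_contra! h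
    have : w = 0 := funext h
    rw [this, Matrix.mulVec_zero] at hVw
    simpa using congrFun hVw ⟨0, hn⟩
  have hzero : ∀ i : Fin n, (i : ℕ) = 0 → d i = 0 := by
    intro i hi
    obtain ⟨j, hj⟩ := hw0
    have hdj : d j = 0 := (mul_eq_zero.1 (hdw j)).resolve_right hj
    exact le_antisymm (hdj ▸ hmono (Fin.le_def.2 (by omega))) (hnonneg i)
  have hconst : ∀ i, d i = 0 → ∀ k, V k i = V ⟨0, hn⟩ i := fun i hi k =>
    eq_of_dotProduct_laplacian_mulVec_eq_zero hK ((hquad i).trans hi) k ⟨0, hn⟩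
  -- Null eigenvectors are constant, so their inner product is `n` times a product of entries. Two
  -- orthonormal ones cannot coexist, which makes the eigenvalue `0` simple.
  have horth : ∀ i j, d i = 0 → d j = 0 →
      (n : ℝ) * (V ⟨0, hn⟩ i * V ⟨0, hn⟩ j) = (1 : Matrix (Fin n) (Fin n) ℝ) i j := by
    intro i j hi hj
    rw [← hV₁, Matrix.mul_apply]
    simp [hconst i hi, hconst j hj]
  have hpos : ∀ i : Fin n, 0 < (i : ℕ) → 0 < d i := by
    intro i hi
    refine (hnonneg i).lt_of_ne' fun hdi => ?_
    have h0 := hzero ⟨0, hn⟩ rfl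
    have hne : (⟨0, hn⟩ : Fin n) ≠ i := fun h => by simp [← h] at hi
    have h1 := horth _ _ h0 hdi
    have h2 := horth _ _ h0 h0
    have h3 := horth _ _ hdi hdi
    rw [Matrix.one_apply_ne hne] at h1
    rw [Matrix.one_apply_eq] at h2 h3
    have : (n : ℝ) * V ⟨0, hn⟩ ⟨0, hn⟩ * V ⟨0, hn⟩ i = 0 := by linarith
    rcases mul_eq_zero.1 this with h | h
    · rw [← mul_assoc, h] at h2; simp at h2
    · rw [h] at h3; simp at h3
  refine ⟨V, hV₁, hV₂, hLV, hzero, hpos, ?_⟩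
  have hwi : ∀ i : Fin n, 0 < (i : ℕ) → w i = 0 := fun i hi =>
    (mul_eq_zero.1 (hdw i)).resolve_left (hpos i hi).ne'
  have hww : w ⟨0, hn⟩ * w ⟨0, hn⟩ = n := by
    have h1 : w ⬝ᵥ w = n := by
      have : w ⬝ᵥ w = (V *ᵥ w) ⬝ᵥ (1 : Fin n → ℝ) := by
        rw [Matrix.mulVec_eq_sum]
        rw [hw, Matrix.dotProduct_mulVec, Matrix.vecMul_transpose, ← hw]
        simp [Matrix.mulVec_eq_sum]
      rw [this, hVw]
      simp
    rw [← h1, dotProduct, Finset.sum_eq_single ⟨0, hn⟩ _ (by simp)]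
    intro b _ hb
    rw [hwi b (Nat.pos_of_ne_zero fun h => hb (Fin.ext h)), zero_mul]
  -- The all-ones matrix is the outer square of `1 = V w`, and `w` is now supported at index `0`
  -- with `w₀² = n`.
  have hJ : (Matrix.of fun _ _ => 1 : Matrix (Fin n) (Fin n) ℝ) =
      V * Matrix.vecMulVec w w * Vᵀ := by
    rw [Matrix.mul_vecMulVec, Matrix.vecMulVec_mul, hVw, Matrix.vecMul_transpose, hVw]
    ext i j
    simp [Matrix.vecMulVec]
  have hD : Matrix.diagonal (fun i : Fin n => if (i : ℕ) = 0 then (0 : ℝ) else 1) =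
      1 - (1 / (n : ℝ)) • Matrix.vecMulVec w w := by
    have hn' : (n : ℝ) ≠ 0 := by positivity
    ext i j
    simp only [Matrix.sub_apply, Matrix.smul_apply, Matrix.vecMulVec_apply, smul_eq_mul]
    rcases Nat.eq_zero_or_pos (i : ℕ) with hi | hi
    · obtain rfl : i = ⟨0, hn⟩ := Fin.ext hi
      rcases Nat.eq_zero_or_pos (j : ℕ) with hj | hj
      · obtain rfl : j = ⟨0, hn⟩ := Fin.ext hj
        simp [hww, hn']
      · have hne : (⟨0, hn⟩ : Fin n) ≠ j := fun h => by simp [← h] at hj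
        simp [hwi j hj, Matrix.one_apply_ne hne, Matrix.diagonal_apply_ne _ hne]
    · simp [hwi i hi, Matrix.diagonal_apply, Matrix.one_apply, hi.ne']
  rw [hD, Matrix.mul_sub, Matrix.sub_mul, Matrix.mul_one, hV₂, Matrix.mul_smul, Matrix.smul_mul,
    ← hJ, centering]

end Diagonalization

/-! ### Peierls' inequality, monotonicity and convexity of the spectral sums. -/

section SpectralConvexity

variable {n : ℕ}

/-- A convex function lies above its tangent at `m`. Scaling reduces to `m = 1`, where `exp u ≥ 1 +
u` and `log y ≤ y - 1` suffice. -/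
theorem rpow_neg_tangent_le {m x q : ℝ} (hm : 0 < m) (hx : 0 < x) (hq : 0 ≤ q) :
    m ^ (-q) - q * m ^ (-q) / m * (x - m) ≤ x ^ (-q) := by
  have h1 : x ^ (-q) = m ^ (-q) * (x / m) ^ (-q) := by
    rw [← Real.mul_rpow hm.le (div_pos hx hm).le, mul_div_cancel₀ _ hm.ne']
  have h2 : 1 - q * (x / m - 1) ≤ (x / m) ^ (-q) := by
    rw [Real.rpow_def_of_pos (div_pos hx hm)]
    have h3 := Real.add_one_le_exp (Real.log (x / m) * -q)
    have h4 := mul_le_mul_of_nonneg_left (Real.log_le_sub_one_of_pos (div_pos hx hm)) hq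
    linarith
  rw [h1]
  have h5 := mul_le_mul_of_nonneg_left h2 (Real.rpow_pos_of_pos hm (-q)).le
  have h6 : m ^ (-q) - q * m ^ (-q) / m * (x - m) = m ^ (-q) * (1 - q * (x / m - 1)) := by
    field_simp
  linarith

/-- Jensen's inequality for the convex function `x ↦ x ^ (-q)`; points of weight zero need not be
positive. -/
theorem rpow_neg_sum_le {ι : Type*} [Fintype ι] {c d : ι → ℝ} {q : ℝ} (hq : 0 ≤ q)
    (hc : ∀ i, 0 ≤ c i) (hc1 : ∑ i, c i = 1) (hd : ∀ i, c i ≠ 0 → 0 < d i) :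
    0 < ∑ i, c i * d i ∧ (∑ i, c i * d i) ^ (-q) ≤ ∑ i, c i * d i ^ (-q) := by
  have hpos : 0 < ∑ i, c i * d i := by
    obtain ⟨i, -, hi⟩ := Finset.exists_ne_zero_of_sum_ne_zero (hc1.symm ▸ one_ne_zero)
    refine Finset.sum_pos' (fun j _ => ?_)
      ⟨i, Finset.mem_univ _, mul_pos ((hc i).lt_of_ne' hi) (hd i hi)⟩
    by_cases hj : c j = 0
    · simp [hj]
    · exact mul_nonneg (hc j) (hd j hj).le
  refine ⟨hpos, ?_⟩
  set m := ∑ i, c i * d i with hm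
  -- Averaging the tangent at the mean `m` leaves its value at `m`: the linear terms cancel.
  calc m ^ (-q) = ∑ i, c i * (m ^ (-q) - q * m ^ (-q) / m * (d i - m)) := by
        have : ∀ i, c i * (m ^ (-q) - q * m ^ (-q) / m * (d i - m)) =
            (m ^ (-q) + q * m ^ (-q) / m * m) * c i - q * m ^ (-q) / m * (c i * d i) :=
          fun i => by ring
        simp only [this, Finset.sum_sub_distrib, ← Finset.mul_sum, hc1, ← hm]
        ring
    _ ≤ _ := by
        refine Finset.sum_le_sum fun i _ => ?_
        by_cases hi : c i = 0
        · simp [hi]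
        · exact mul_le_mul_of_nonneg_left (rpow_neg_tangent_le hpos (hd i hi) hq) (hc i)

theorem sum_subtype_pos {M : Type*} [AddCommMonoid M] (f : Fin n → M)
    (hf : ∀ i : Fin n, (i : ℕ) = 0 → f i = 0) :
    ∑ i : {i : Fin n // 0 < (i : ℕ)}, f i = ∑ i, f i := by
  rw [← Finset.sum_subtype (Finset.univ.filter fun i : Fin n => 0 < (i : ℕ)) (by simp) f,
    Finset.sum_filter_of_ne]
  exact fun i _ hi => Nat.pos_of_ne_zero fun h0 => hi (hf i h0)

theorem IsDiagonalization.conj_eq {L V : Matrix (Fin n) (Fin n) ℝ} {d : Fin n → ℝ}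
    (h : IsDiagonalization L V d) : Vᵀ * L * V = Matrix.diagonal d := by
  rw [h.eq]
  calc Vᵀ * (V * Matrix.diagonal d * Vᵀ) * V
      = (Vᵀ * V) * Matrix.diagonal d * (Vᵀ * V) := by simp only [Matrix.mul_assoc]
    _ = _ := by rw [h.transpose_mul, Matrix.one_mul, Matrix.mul_one]

/-- Peierls' inequality: the diagonal entries of `L` in the eigenbasis of another Laplacian matrix
are positive, and the sum of their powers of exponent `-q` is at most that of the eigenvalues. -/
theorem IsDiagonalization.sum_diag_rpow_neg_le {L V L' W : Matrix (Fin n) (Fin n) ℝ}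
    {d d' : Fin n → ℝ} (h : IsDiagonalization L V d) (h' : IsDiagonalization L' W d') {q : ℝ}
    (hq : 0 ≤ q) :
    (∀ i : Fin n, 0 < (i : ℕ) → 0 < (Wᵀ * L * W) i i) ∧
    ∑ i : {i : Fin n // 0 < (i : ℕ)}, ((Wᵀ * L * W) i i) ^ (-q) ≤
      ∑ i : {i : Fin n // 0 < (i : ℕ)}, d i ^ (-q) := by
  -- The change of basis is orthogonal, so the squares of its entries form a doubly stochastic
  -- matrix: column sums give the Jensen weights, row sums the final bound.
  set A := Vᵀ * W with hA
  have hA₁ : Aᵀ * A = 1 := by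
    calc Aᵀ * A = Wᵀ * (V * Vᵀ) * W := by
          simp only [hA, Matrix.transpose_mul, Matrix.transpose_transpose, Matrix.mul_assoc]
      _ = 1 := by rw [h.mul_transpose, Matrix.mul_one, h'.transpose_mul]
  have hA₂ : A * Aᵀ = 1 := mul_eq_one_comm.1 hA₁
  have hcol : ∀ i, ∑ j, A j i ^ 2 = 1 := fun i => by
    have := congrFun (congrFun hA₁ i) i
    rw [Matrix.mul_apply, Matrix.one_apply_eq] at this
    simpa [sq] using this
  have hrow : ∀ j, ∑ i, A j i ^ 2 = 1 := fun j => by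
    have := congrFun (congrFun hA₂ j) j
    rw [Matrix.mul_apply, Matrix.one_apply_eq] at this
    simpa [sq] using this
  have hentry : ∀ i, (Wᵀ * L * W) i i = ∑ j, A j i ^ 2 * d j := fun i => by
    have : Wᵀ * L * W = Aᵀ * Matrix.diagonal d * A := by
      rw [h.eq]
      simp only [hA, Matrix.transpose_mul, Matrix.transpose_transpose, Matrix.mul_assoc]
    rw [this, Matrix.mul_apply]
    refine Finset.sum_congr rfl fun j _ => ?_
    rw [Matrix.mul_diagonal, Matrix.transpose_apply]
    ring
  -- Both bases diagonalize the same centering matrix, so `A` commutes with its diagonal form and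
  -- does not mix the zero mode with the others. Jensen's inequality thus never meets the eigenvalue
  -- `0`.
  have hcross : ∀ i j : Fin n, 0 < (i : ℕ) → (j : ℕ) = 0 → A j i = 0 := fun i j hi hj => by
    set D := Matrix.diagonal (fun i : Fin n => if (i : ℕ) = 0 then (0 : ℝ) else 1) with hD
    have h1 : D * A = A * D := by
      calc D * A = (Vᵀ * V) * D * (Vᵀ * W) := by rw [h.transpose_mul, Matrix.one_mul]
        _ = Vᵀ * (V * D * Vᵀ) * W := by simp only [Matrix.mul_assoc]
        _ = Vᵀ * (W * D * Wᵀ) * W := by rw [← h.centering_eq, h'.centering_eq]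
        _ = A * D * (Wᵀ * W) := by simp only [hA, Matrix.mul_assoc]
        _ = A * D := by rw [h'.transpose_mul, Matrix.mul_one]
    have h2 := congrFun (congrFun h1 j) i
    simpa [hD, Matrix.diagonal_mul, Matrix.mul_diagonal, hj, hi.ne'] using h2.symm
  have hjensen : ∀ i : Fin n, 0 < (i : ℕ) → 0 < (Wᵀ * L * W) i i ∧
      ((Wᵀ * L * W) i i) ^ (-q) ≤
        ∑ j : {j : Fin n // 0 < (j : ℕ)}, A j i ^ 2 * d j ^ (-q) := fun i hi => by
    have h1 := rpow_neg_sum_le hq (fun j => sq_nonneg (A j i)) (hcol i) (d := d) fun j hj =>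
      h.pos j (Nat.pos_of_ne_zero fun h0 => hj (by rw [hcross i j hi h0]; norm_num))
    rw [hentry, sum_subtype_pos fun j => A j i ^ 2 * d j ^ (-q)]
    · exact h1
    · intro j hj
      rw [hcross i j hi hj]
      simp
  refine ⟨fun i hi => (hjensen i hi).1, ?_⟩
  refine (Finset.sum_le_sum fun (i : {i : Fin n // 0 < (i : ℕ)}) _ =>
    (hjensen i i.2).2).trans ?_
  rw [Finset.sum_comm]
  refine Finset.sum_le_sum fun j _ => ?_
  rw [← Finset.sum_mul]
  refine mul_le_of_le_one_left (Real.rpow_nonneg (h.pos j j.2).le _) ?_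
  rw [← hrow j, ← Finset.sum_subtype (Finset.univ.filter fun i : Fin n => 0 < (i : ℕ)) (by simp)
    fun i => A j i ^ 2]
  exact Finset.sum_le_univ_sum_of_nonneg fun i => sq_nonneg _

/-- In the eigenbasis of `L₁`, the diagonal entries of `L₂` are at most the eigenvalues of `L₁`;
Peierls' inequality then compares them with the spectrum of `L₂`. -/
theorem IsDiagonalization.sum_rpow_neg_le_of_posSemidef {L₁ V₁ L₂ V₂ : Matrix (Fin n) (Fin n) ℝ}
    {d₁ d₂ : Fin n → ℝ} (h₁ : IsDiagonalization L₁ V₁ d₁) (h₂ : IsDiagonalization L₂ V₂ d₂)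
    (hle : (L₁ - L₂).PosSemidef) {q : ℝ} (hq : 0 ≤ q) :
    ∑ i : {i : Fin n // 0 < (i : ℕ)}, d₁ i ^ (-q) ≤
      ∑ i : {i : Fin n // 0 < (i : ℕ)}, d₂ i ^ (-q) := by
  obtain ⟨hpos, hsum⟩ := h₂.sum_diag_rpow_neg_le h₁ hq
  refine (Finset.sum_le_sum fun i _ => ?_).trans hsum
  refine Real.rpow_le_rpow_of_nonpos (hpos i i.2) ?_ (neg_nonpos.2 hq)
  have h := (hle.conjTranspose_mul_mul_same V₁).diag_nonneg (i := i)
  rw [Matrix.conjTranspose_eq_transpose_of_trivial, Matrix.mul_sub, Matrix.sub_mul, h₁.conj_eq,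
    Matrix.sub_apply, Matrix.diagonal_apply_eq] at h
  linarith

/-- Log-convexity: AM-GM bounds each term by a product, Hölder with exponents `1/a`, `1/b` sums the
products, and a second AM-GM turns the geometric mean into an arithmetic one. Taking the power `t`
between the last two steps is harmless. -/
theorem sum_rpow_neg_combination_le {ι : Type*} [Fintype ι] {x y : ι → ℝ} (hx : ∀ i, 0 < x i)
    (hy : ∀ i, 0 < y i) {a b q t : ℝ} (ha : 0 < a) (hb : 0 < b) (hab : a + b = 1) (hq : 0 ≤ q)
    (ht : 0 ≤ t) :
    (∑ i, (a * x i + b * y i) ^ (-q)) ^ t ≤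
      a * (∑ i, x i ^ (-q)) ^ t + b * (∑ i, y i ^ (-q)) ^ t := by
  have hS : 0 ≤ ∑ i, x i ^ (-q) := Finset.sum_nonneg fun i _ => Real.rpow_nonneg (hx i).le _
  have hT : 0 ≤ ∑ i, y i ^ (-q) := Finset.sum_nonneg fun i _ => Real.rpow_nonneg (hy i).le _
  have hmain : ∑ i, (a * x i + b * y i) ^ (-q) ≤
      (∑ i, x i ^ (-q)) ^ a * (∑ i, y i ^ (-q)) ^ b := by
    have hconj : (1 / a).HolderConjugate (1 / b) := by
      refine Real.holderConjugate_iff.2 ⟨?_, by simpa using hab⟩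
      rw [lt_div_iff₀ ha]
      linarith
    refine le_trans (Finset.sum_le_sum fun i _ => ?_) ((Real.inner_le_Lp_mul_Lq Finset.univ
      (fun i => (x i ^ (-q)) ^ a) (fun i => (y i ^ (-q)) ^ b) hconj).trans_eq ?_)
    · have h := Real.geom_mean_le_arith_mean2_weighted ha.le hb.le (hx i).le (hy i).le hab
      refine (Real.rpow_le_rpow_of_nonpos (mul_pos (Real.rpow_pos_of_pos (hx i) a)
        (Real.rpow_pos_of_pos (hy i) b)) h (neg_nonpos.2 hq)).trans_eq ?_
      rw [Real.mul_rpow (Real.rpow_nonneg (hx i).le _) (Real.rpow_nonneg (hy i).le _),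
        ← Real.rpow_mul (hx i).le, ← Real.rpow_mul (hy i).le, ← Real.rpow_mul (hx i).le,
        ← Real.rpow_mul (hy i).le, mul_comm a, mul_comm b]
    · have hpow : ∀ {z c : ℝ}, 0 < z → 0 < c → |(z ^ (-q)) ^ c| ^ (1 / c) = z ^ (-q) := by
        intro z c hz hc
        have hz' := Real.rpow_nonneg hz.le (-q)
        rw [abs_of_nonneg (Real.rpow_nonneg hz' _), ← Real.rpow_mul hz', mul_one_div_cancel hc.ne',
          Real.rpow_one]
      simp only [hpow (hx _) ha, hpow (hy _) hb, one_div_one_div]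
  calc (∑ i, (a * x i + b * y i) ^ (-q)) ^ t
      ≤ ((∑ i, x i ^ (-q)) ^ a * (∑ i, y i ^ (-q)) ^ b) ^ t :=
        Real.rpow_le_rpow (Finset.sum_nonneg fun i _ => Real.rpow_nonneg
          (add_pos (mul_pos ha (hx i)) (mul_pos hb (hy i))).le _) hmain ht
    _ = ((∑ i, x i ^ (-q)) ^ t) ^ a * ((∑ i, y i ^ (-q)) ^ t) ^ b := by
        rw [Real.mul_rpow (Real.rpow_nonneg hS _) (Real.rpow_nonneg hT _), ← Real.rpow_mul hS,
          ← Real.rpow_mul hT, ← Real.rpow_mul hS, ← Real.rpow_mul hT, mul_comm a, mul_comm b]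
    _ ≤ _ := Real.geom_mean_le_arith_mean2_weighted ha.le hb.le (Real.rpow_nonneg hS _)
        (Real.rpow_nonneg hT _) hab

/-- In the eigenbasis of the combination, its eigenvalues are the combinations of the diagonal
entries of `L₁` and `L₂`, so the vector inequality applies before Peierls'. -/
theorem IsDiagonalization.sum_rpow_neg_convex {L₁ V₁ L₂ V₂ L V : Matrix (Fin n) (Fin n) ℝ}
    {d₁ d₂ d : Fin n → ℝ} (h₁ : IsDiagonalization L₁ V₁ d₁) (h₂ : IsDiagonalization L₂ V₂ d₂)
    (h : IsDiagonalization L V d) {a b q t : ℝ} (ha : 0 < a) (hb : 0 < b) (hab : a + b = 1)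
    (hL : L = a • L₁ + b • L₂) (hq : 0 ≤ q) (ht : 0 ≤ t) :
    (∑ i : {i : Fin n // 0 < (i : ℕ)}, d i ^ (-q)) ^ t ≤
      a * (∑ i : {i : Fin n // 0 < (i : ℕ)}, d₁ i ^ (-q)) ^ t +
        b * (∑ i : {i : Fin n // 0 < (i : ℕ)}, d₂ i ^ (-q)) ^ t := by
  obtain ⟨hpos₁, hsum₁⟩ := h₁.sum_diag_rpow_neg_le h hq
  obtain ⟨hpos₂, hsum₂⟩ := h₂.sum_diag_rpow_neg_le h hq
  have hd : ∀ i, d i = a * (Vᵀ * L₁ * V) i i + b * (Vᵀ * L₂ * V) i i := by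
    intro i
    have := congrFun (congrFun h.conj_eq i) i
    rw [Matrix.diagonal_apply_eq] at this
    rw [← this, hL]
    simp [Matrix.mul_add, Matrix.add_mul]
  simp only [hd]
  refine (sum_rpow_neg_combination_le (fun i : {i : Fin n // 0 < (i : ℕ)} => hpos₁ i i.2)
    (fun i => hpos₂ i i.2) ha hb hab hq ht).trans (add_le_add
      (mul_le_mul_of_nonneg_left (Real.rpow_le_rpow ?_ hsum₁ ht) ha.le)
      (mul_le_mul_of_nonneg_left (Real.rpow_le_rpow ?_ hsum₂ ht) hb.le))
  · exact Finset.sum_nonneg fun i _ => Real.rpow_nonneg (hpos₁ i i.2).le _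
  · exact Finset.sum_nonneg fun i _ => Real.rpow_nonneg (hpos₂ i i.2).le _

end SpectralConvexity

/-! ### Singular values of a unitarily diagonalized matrix. -/

section SingularValues

variable {n : ℕ}

/-- The roots of the characteristic polynomial of `Gᴴ G` are the `‖g i‖²`. Multisets are compared
because singular values are sorted while the `g i` come in any order. -/
theorem map_singularValue_eq {G V : Matrix (Fin n) (Fin n) ℂ} {g : Fin n → ℂ} (hV : Vᴴ * V = 1)
    (hG : G = V * Matrix.diagonal g * Vᴴ) :
    Finset.univ.val.map (fun k : Fin n => singularValue G k) =
      Finset.univ.val.map fun i => ‖g i‖ := by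
  set T := Matrix.toEuclideanLin G with hT
  have hchar : (LinearMap.adjoint T ∘ₗ T).charpoly =
      ∏ i, (Polynomial.X - Polynomial.C ((‖g i‖ ^ 2 : ℝ) : ℂ)) := by
    have hGG : Gᴴ * G = V * Matrix.diagonal (fun i => ((‖g i‖ ^ 2 : ℝ) : ℂ)) * Vᴴ := by
      calc Gᴴ * G = V * (Matrix.diagonal (star g) * (Vᴴ * V) * Matrix.diagonal g) * Vᴴ := by
            simp only [hG, Matrix.conjTranspose_mul, Matrix.conjTranspose_conjTranspose,
              Matrix.diagonal_conjTranspose, Matrix.mul_assoc]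
        _ = _ := by
            rw [hV, Matrix.mul_one, Matrix.diagonal_mul_diagonal]
            congr 3
            ext i
            simp [Complex.conj_mul']
    rw [hT, ← Matrix.toEuclideanLin_conjTranspose_eq_adjoint, Matrix.toEuclideanLin,
      ← Matrix.toLpLin_mul_same, Matrix.toLpLin_eq_toLin, Matrix.charpoly_toLin, hGG,
      Matrix.charpoly_mul_comm, ← Matrix.mul_assoc, hV, Matrix.one_mul, Matrix.charpoly_diagonal]
  have hroots := T.isSymmetric_adjoint_comp_self.roots_charpoly_eq_eigenvalues
    (finrank_euclideanSpace_fin (𝕜 := ℂ) (n := n))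
  rw [hchar, Polynomial.roots_prod _ _
    (Finset.prod_ne_zero_iff.2 fun i _ => Polynomial.X_sub_C_ne_zero _)] at hroots
  simp only [Polynomial.roots_X_sub_C, Multiset.bind_singleton] at hroots
  have h := congrArg (Multiset.map fun z : ℂ => √z.re) hroots
  rw [Multiset.map_map, Multiset.map_map] at h
  refine (Multiset.map_congr rfl fun k _ => ?_).trans
    (h.symm.trans (Multiset.map_congr rfl fun i _ => ?_))
  · exact (T.singularValues_fin finrank_euclideanSpace_fin k).trans
      (congrArg Real.sqrt (Complex.ofReal_re _).symm)
  · rw [Function.comp_apply, Complex.ofReal_re, Real.sqrt_sq (norm_nonneg _)]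

theorem sum_singularValue_eq {M : Type*} [AddCommMonoid M] {G V : Matrix (Fin n) (Fin n) ℂ}
    {g : Fin n → ℂ} (hV : Vᴴ * V = 1) (hG : G = V * Matrix.diagonal g * Vᴴ) (F : ℝ → M) :
    ∑ k : Fin n, F (singularValue G k) = ∑ i, F ‖g i‖ := by
  have h := congrArg (fun s => (Multiset.map F s).sum) (map_singularValue_eq hV hG)
  rwa [Multiset.map_map, Multiset.map_map] at h

theorem exists_singularValue_zero_eq {G V : Matrix (Fin n) (Fin n) ℂ} {g : Fin n → ℂ}
    (hV : Vᴴ * V = 1) (hG : G = V * Matrix.diagonal g * Vᴴ) (hn : 0 < n) :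
    ∃ i, singularValue G 0 = ‖g i‖ := by
  have h : singularValue G 0 ∈ Finset.univ.val.map (fun k : Fin n => singularValue G k) :=
    Multiset.mem_map.2 ⟨⟨0, hn⟩, Finset.mem_univ_val _, rfl⟩
  rw [map_singularValue_eq hV hG] at h
  obtain ⟨i, -, hi⟩ := Multiset.mem_map.1 h
  exact ⟨i, hi.symm⟩

theorem norm_le_singularValue_zero {G V : Matrix (Fin n) (Fin n) ℂ} {g : Fin n → ℂ}
    (hV : Vᴴ * V = 1) (hG : G = V * Matrix.diagonal g * Vᴴ) (i : Fin n) :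
    ‖g i‖ ≤ singularValue G 0 := by
  have h : ‖g i‖ ∈ Finset.univ.val.map fun i => ‖g i‖ :=
    Multiset.mem_map.2 ⟨i, Finset.mem_univ_val _, rfl⟩
  rw [← map_singularValue_eq hV hG] at h
  obtain ⟨k, -, hk⟩ := Multiset.mem_map.1 h
  exact hk ▸ LinearMap.singularValues_antitone _ (Nat.zero_le _)

end SingularValues

/-! ### Spectral form of the transfer matrix. -/

section TransferMatrix

variable {n : ℕ}

/-- The eigenvalues of the transfer matrix `Mₙ (s I + L)⁻¹` when `d` are those of `L`. -/
noncomputable def transferEigenvalue (d : Fin n → ℝ) (s : ℂ) (i : Fin n) : ℂ :=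
  if (i : ℕ) = 0 then 0 else (s + d i)⁻¹

theorem norm_transferEigenvalue_of_pos {d : Fin n → ℝ} {i : Fin n} (hi : 0 < (i : ℕ)) (ω : ℝ) :
    ‖transferEigenvalue d (Complex.I * ω) i‖ = (√(d i ^ 2 + ω ^ 2))⁻¹ := by
  rw [transferEigenvalue, if_neg hi.ne', norm_inv, Complex.norm_def, Complex.normSq_apply]
  simp [sq]

theorem IsDiagonalization.transferMatrix_eq {L V : Matrix (Fin n) (Fin n) ℝ} {d : Fin n → ℝ}
    (h : IsDiagonalization L V d) {s : ℂ} (hs : ∀ i, s + d i ≠ 0) :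
    (V.map Complex.ofReal)ᴴ * V.map Complex.ofReal = 1 ∧
    transferMatrix (-L) 1 (centering n) s =
      V.map Complex.ofReal * Matrix.diagonal (transferEigenvalue d s) *
        (V.map Complex.ofReal)ᴴ := by
  set U := V.map Complex.ofReal with hU
  have hUt : Uᴴ = Vᵀ.map Complex.ofReal := by
    ext i j
    simp [hU]
  have hmul : ∀ A B : Matrix (Fin n) (Fin n) ℝ, (A * B).map Complex.ofReal =
      A.map Complex.ofReal * B.map Complex.ofReal := fun A B =>
    Matrix.map_mul (f := Complex.ofRealHom)
  have hone : (1 : Matrix (Fin n) (Fin n) ℝ).map Complex.ofReal = 1 :=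
    Matrix.map_one _ Complex.ofReal_zero Complex.ofReal_one
  have hU₁ : Uᴴ * U = 1 := by rw [hUt, hU, ← hmul, h.transpose_mul, hone]
  have hU₂ : U * Uᴴ = 1 := mul_eq_one_comm.1 hU₁
  refine ⟨hU₁, ?_⟩
  have hdiag : ∀ f : Fin n → ℝ, (V * Matrix.diagonal f * Vᵀ).map Complex.ofReal =
      U * Matrix.diagonal (fun i => (f i : ℂ)) * Uᴴ := fun f => by
    rw [hmul, hmul, hUt, Matrix.diagonal_map Complex.ofReal_zero]
  have hprod : ∀ f g : Fin n → ℂ, (U * Matrix.diagonal f * Uᴴ) * (U * Matrix.diagonal g * Uᴴ) =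
      U * Matrix.diagonal (fun i => f i * g i) * Uᴴ := fun f g => by
    calc _ = U * (Matrix.diagonal f * (Uᴴ * U) * Matrix.diagonal g) * Uᴴ := by
          simp only [Matrix.mul_assoc]
      _ = _ := by rw [hU₁, Matrix.mul_one, Matrix.diagonal_mul_diagonal]
  have hres : s • 1 - (-L).map Complex.ofReal =
      U * Matrix.diagonal (fun i => s + d i) * Uᴴ := by
    have h1 : (-L).map Complex.ofReal = -(L.map Complex.ofReal) := by
      ext i j
      simp
    have h2 : Matrix.diagonal (fun i => s + (d i : ℂ)) =
        s • 1 + Matrix.diagonal (fun i => (d i : ℂ)) := by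
      rw [← Matrix.diagonal_one, ← Matrix.diagonal_smul, Matrix.diagonal_add]
      congr 1
      ext i
      simp
    rw [h1, sub_neg_eq_add, h.eq, hdiag, h2, Matrix.mul_add, Matrix.add_mul, Matrix.mul_smul,
      Matrix.smul_mul, Matrix.mul_one, hU₂]
  have hinv : (s • 1 - (-L).map Complex.ofReal)⁻¹ =
      U * Matrix.diagonal (fun i => (s + (d i : ℂ))⁻¹) * Uᴴ := by
    refine Matrix.inv_eq_right_inv ?_
    rw [hres, hprod]
    simp only [mul_inv_cancel₀ (hs _)]
    rw [Matrix.diagonal_one, Matrix.mul_one, hU₂]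
  rw [transferMatrix, hinv, hone, Matrix.mul_one, h.centering_eq, hdiag, hprod]
  congr 3
  ext i
  simp only [transferEigenvalue]
  split_ifs <;> simp

theorem I_mul_add_ofReal_ne_zero {ω : ℝ} (hω : ω ≠ 0) (x : ℝ) : Complex.I * ω + x ≠ 0 := fun h0 => hω (by simpa using congrArg Complex.im h0)

end TransferMatrix

/-! ### Evaluation of the frequency integral. -/

section Integral

theorem lintegral_rpow_mul_exp_neg_mul_Ioi {s r : ℝ} (hs : 0 < s) (hr : 0 < r) :
    ∫⁻ t in Set.Ioi (0 : ℝ), ENNReal.ofReal (t ^ (s - 1) * Real.exp (-(r * t))) =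
      ENNReal.ofReal ((1 / r) ^ s * Real.Gamma s) := by
  have h := Real.integral_rpow_mul_exp_neg_mul_Ioi hs hr
  have hpos : 0 < (1 / r) ^ s * Real.Gamma s :=
    mul_pos (Real.rpow_pos_of_pos (by positivity) _) (Real.Gamma_pos_of_pos hs)
  rw [← h, ofReal_integral_eq_lintegral_ofReal]
  -- A nonintegrable function has integral `0` by convention, so the positive value itself gives
  -- integrability.
  · exact Integrable.of_integral_ne_zero (h ▸ hpos.ne')
  · filter_upwards [ae_restrict_mem measurableSet_Ioi] with t ht
    exact mul_nonneg (Real.rpow_nonneg (le_of_lt ht) _) (Real.exp_pos _).le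

theorem lintegral_exp_neg_mul_sq {t : ℝ} (ht : 0 < t) :
    ∫⁻ ω : ℝ, ENNReal.ofReal (Real.exp (-t * ω ^ 2)) = ENNReal.ofReal √(Real.pi / t) := by
  rw [← integral_gaussian, ofReal_integral_eq_lintegral_ofReal (integrable_exp_neg_mul_sq ht)]
  exact ae_of_all _ fun _ => (Real.exp_pos _).le

/-- `∫ (a² + ω²) ^ (-s) dω = √π Γ(s - 1/2) / Γ(s) * a ^ (1 - 2 s)`. -/
theorem lintegral_sq_add_sq_rpow_neg {a s : ℝ} (ha : 0 < a) (hs : 1 / 2 < s) :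
    ∫⁻ ω : ℝ, ENNReal.ofReal ((a ^ 2 + ω ^ 2) ^ (-s)) =
      ENNReal.ofReal (√Real.pi * Real.Gamma (s - 1 / 2) / Real.Gamma s * a ^ (-(2 * s - 1))) := by
  have hs0 : 0 < s := by linarith
  have hΓ := Real.Gamma_pos_of_pos hs0
  have hpos : ∀ ω : ℝ, 0 < a ^ 2 + ω ^ 2 := fun ω => by positivity
  -- Write `Γ(s) x^(-s)` as `∫ t^(s-1) e^(-xt) dt` with `x = a² + ω²`. After Tonelli the inner
  -- integral is Gaussian in `ω` and the outer one is again a Gamma integral.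
  have h1 : ∀ ω : ℝ, ENNReal.ofReal (Real.Gamma s) * ENNReal.ofReal ((a ^ 2 + ω ^ 2) ^ (-s)) =
      ∫⁻ t in Set.Ioi (0 : ℝ), ENNReal.ofReal (t ^ (s - 1) * Real.exp (-((a ^ 2 + ω ^ 2) * t))) :=
    fun ω => by
      rw [lintegral_rpow_mul_exp_neg_mul_Ioi hs0 (hpos ω), ← ENNReal.ofReal_mul hΓ.le,
        Real.rpow_neg (hpos ω).le, one_div, Real.inv_rpow (hpos ω).le, mul_comm]
  have h2 : ∀ t ∈ Set.Ioi (0 : ℝ),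
      ∫⁻ ω : ℝ, ENNReal.ofReal (t ^ (s - 1) * Real.exp (-((a ^ 2 + ω ^ 2) * t))) =
        ENNReal.ofReal √Real.pi *
          ENNReal.ofReal (t ^ (s - 1 / 2 - 1) * Real.exp (-(a ^ 2 * t))) := fun t ht => by
    have ht : 0 < t := ht
    have h3 : ∀ ω : ℝ, ENNReal.ofReal (t ^ (s - 1) * Real.exp (-((a ^ 2 + ω ^ 2) * t))) =
        ENNReal.ofReal (t ^ (s - 1) * Real.exp (-(a ^ 2 * t))) *
          ENNReal.ofReal (Real.exp (-t * ω ^ 2)) := fun ω => by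
      rw [← ENNReal.ofReal_mul (by positivity), mul_assoc, ← Real.exp_add]
      congr 3
      ring
    simp only [h3]
    rw [lintegral_const_mul _ (by fun_prop), lintegral_exp_neg_mul_sq ht,
      ← ENNReal.ofReal_mul (by positivity), ← ENNReal.ofReal_mul (by positivity),
      Real.sqrt_div Real.pi_pos.le, show s - 1 / 2 - 1 = (s - 1) - 1 / 2 by ring,
      Real.rpow_sub ht (s - 1) (1 / 2), ← Real.sqrt_eq_rpow]
    congr 1
    ring
  have hkey : ENNReal.ofReal (Real.Gamma s) * ∫⁻ ω : ℝ, ENNReal.ofReal ((a ^ 2 + ω ^ 2) ^ (-s)) =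
      ENNReal.ofReal (√Real.pi * ((1 / a ^ 2) ^ (s - 1 / 2) * Real.Gamma (s - 1 / 2))) := by
    rw [← lintegral_const_mul' _ _ ENNReal.ofReal_ne_top]
    simp only [h1]
    rw [lintegral_lintegral_swap, setLIntegral_congr_fun measurableSet_Ioi h2,
      lintegral_const_mul' _ _ ENNReal.ofReal_ne_top,
      lintegral_rpow_mul_exp_neg_mul_Ioi (by linarith) (by positivity),
      ← ENNReal.ofReal_mul (by positivity)]
    exact (by fun_prop : Measurable (Function.uncurry fun (ω t : ℝ) =>
      ENNReal.ofReal (t ^ (s - 1) * Real.exp (-((a ^ 2 + ω ^ 2) * t))))).aemeasurable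
  have hΓ0 : ENNReal.ofReal (Real.Gamma s) ≠ 0 := by simpa using hΓ
  rw [← ENNReal.mul_right_inj hΓ0 ENNReal.ofReal_ne_top, hkey, ← ENNReal.ofReal_mul hΓ.le]
  congr 1
  have ha2 : (1 / a ^ 2) ^ (s - 1 / 2) = a ^ (-(2 * s - 1)) := by
    rw [one_div, Real.inv_rpow (by positivity), ← Real.rpow_natCast, ← Real.rpow_mul ha.le,
      Real.rpow_neg ha.le]
    congr 2
    push_cast
    ring
  rw [ha2]
  field_simp

end Integral

/-! ### The formula and the performance-measure properties for finite `p`. -/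

section FiniteOrder

variable {n : ℕ}

theorem neg_beta_neg_half {r : ℝ} :
    -ProbabilityTheory.beta (r / 2) (-1 / 2) =
      2 * √Real.pi * Real.Gamma (r / 2) / Real.Gamma ((r - 1) / 2) := by
  have h : Real.Gamma (-1 / 2) = -(2 * √Real.pi) := by
    have h1 := Real.Gamma_add_one (show (-1 / 2 : ℝ) ≠ 0 by norm_num)
    rw [show (-1 / 2 : ℝ) + 1 = 1 / 2 by norm_num, Real.Gamma_one_half_eq] at h1
    linarith
  rw [ProbabilityTheory.beta, h, show r / 2 + -1 / 2 = (r - 1) / 2 by ring]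
  ring

theorem neg_beta_neg_half_pos {r : ℝ} (hr : 1 < r) :
    0 < -ProbabilityTheory.beta (r / 2) (-1 / 2) := by
  rw [neg_beta_neg_half]
  have h1 := Real.Gamma_pos_of_pos (show 0 < r / 2 by linarith)
  have h2 := Real.Gamma_pos_of_pos (show 0 < (r - 1) / 2 by linarith)
  positivity

theorem alphaZero_of_ne_top {p : ℝ≥0∞} (hp : p ≠ ∞) :
    alphaZero p = ((-ProbabilityTheory.beta (p.toReal / 2) (-1 / 2)) ^ (1 / p.toReal))⁻¹ :=
  if_neg hp

theorem alphaZero_nonneg {p : ℝ≥0∞} (hp : p ≠ ∞) (h1 : 1 < p.toReal) : 0 ≤ alphaZero p := by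
  rw [alphaZero_of_ne_top hp]
  exact inv_nonneg.2 (Real.rpow_nonneg (neg_beta_neg_half_pos h1).le _)

theorem lintegral_inv_sqrt_rpow {a r : ℝ} (ha : 0 < a) (hr : 1 < r) :
    ENNReal.ofReal (1 / (2 * Real.pi)) *
        ∫⁻ ω : ℝ, ENNReal.ofReal ((√(a ^ 2 + ω ^ 2))⁻¹ ^ r) =
      ENNReal.ofReal ((-ProbabilityTheory.beta (r / 2) (-1 / 2))⁻¹ * a ^ (-(r - 1))) := by
  have h : ∀ ω : ℝ, (√(a ^ 2 + ω ^ 2))⁻¹ ^ r = (a ^ 2 + ω ^ 2) ^ (-(r / 2)) := fun ω => by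
    have hpos : 0 ≤ a ^ 2 + ω ^ 2 := by positivity
    rw [Real.inv_rpow (Real.sqrt_nonneg _), Real.sqrt_eq_rpow, ← Real.rpow_mul hpos,
      Real.rpow_neg hpos]
    congr 2
    ring
  simp only [h]
  rw [lintegral_sq_add_sq_rpow_neg ha (by linarith), ← ENNReal.ofReal_mul (by positivity),
    neg_beta_neg_half, show r / 2 - 1 / 2 = (r - 1) / 2 by ring,
    show 2 * (r / 2) - 1 = r - 1 by ring]
  congr 1
  have h1 := Real.Gamma_pos_of_pos (show 0 < r / 2 by linarith)
  have h2 := Real.Gamma_pos_of_pos (show 0 < (r - 1) / 2 by linarith)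
  have h3 : Real.pi = √Real.pi * √Real.pi := (Real.mul_self_sqrt Real.pi_pos.le).symm
  have h4 : 0 < √Real.pi := Real.sqrt_pos.2 Real.pi_pos
  conv_lhs => rw [h3, Real.sqrt_mul_self h4.le]
  field_simp

/-- Monotonicity and convexity are read off this form. The right side being an `ENNReal.ofReal`, it
also gives finiteness. -/
theorem networkNorm_of_ne_top {L : Matrix (Fin n) (Fin n) ℝ} (hL : L ∈ laplacians n) {p : ℝ≥0∞}
    (hp : p ≠ ∞) (h1 : 1 < p.toReal) :
    networkNorm p L = ENNReal.ofReal (alphaZero p *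
      (∑ i : {i : Fin n // 0 < (i : ℕ)},
        eigenvalue (isHermitian_of_mem_laplacians hL) i ^ (-(p.toReal - 1))) ^
          (1 / p.toReal)) := by
  obtain ⟨V, hV⟩ := exists_isDiagonalization hL
  set d := eigenvalue (isHermitian_of_mem_laplacians hL)
  set r := p.toReal with hr
  have hB := neg_beta_neg_half_pos h1
  have hS : 0 ≤ ∑ i : {i : Fin n // 0 < (i : ℕ)}, d i ^ (-(r - 1)) :=
    Finset.sum_nonneg fun i _ => Real.rpow_nonneg (hV.pos i i.2).le _
  have hae : ∀ᵐ ω : ℝ, ∑ k : Fin n, ENNReal.ofReal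
      (singularValue (transferMatrix (-L) 1 (centering n) (Complex.I * ω)) k ^ r) =
      ∑ i : {i : Fin n // 0 < (i : ℕ)},
        ENNReal.ofReal ((√(d i ^ 2 + ω ^ 2))⁻¹ ^ r) := by
    -- At `ω = 0` the matrix `s I + L` is singular and its formal inverse is a default value; this
    -- one frequency is a null set.
    filter_upwards [Measure.ae_ne volume (0 : ℝ)] with ω hω
    obtain ⟨hU, hG⟩ := hV.transferMatrix_eq fun i => I_mul_add_ofReal_ne_zero hω (d i)
    rw [sum_singularValue_eq hU hG fun x => ENNReal.ofReal (x ^ r),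
      ← sum_subtype_pos fun i => ENNReal.ofReal (‖transferEigenvalue d (Complex.I * ω) i‖ ^ r)]
    · exact Finset.sum_congr rfl fun i _ => by rw [norm_transferEigenvalue_of_pos i.2]
    · intro i hi
      simp [transferEigenvalue, hi, Real.zero_rpow (by linarith : r ≠ 0)]
  rw [networkNorm, hardySchattenNorm, if_neg hp, lintegral_congr_ae hae, lintegral_finsetSum,
    Finset.mul_sum]
  · rw [Finset.sum_congr rfl fun (i : {i : Fin n // 0 < (i : ℕ)}) _ =>
        lintegral_inv_sqrt_rpow (hV.pos i i.2) h1,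
      ← ENNReal.ofReal_sum_of_nonneg fun (i : {i : Fin n // 0 < (i : ℕ)}) _ =>
        mul_nonneg (inv_nonneg.2 hB.le) (Real.rpow_nonneg (hV.pos i i.2).le _), ← Finset.mul_sum,
      ENNReal.ofReal_rpow_of_nonneg (mul_nonneg (inv_nonneg.2 hB.le) hS) (by positivity),
      Real.mul_rpow (inv_nonneg.2 hB.le) hS, Real.inv_rpow hB.le, alphaZero_of_ne_top hp]
  · intro i _
    fun_prop

theorem networkNorm_eq_spectralZeta_of_ne_top {L : Matrix (Fin n) (Fin n) ℝ}
    (hL : L ∈ laplacians n) {p : ℝ≥0∞} (hp : p ≠ ∞) (h1 : 1 < p.toReal) :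
    networkNorm p L = ENNReal.ofReal (alphaZero p *
      spectralZeta (isHermitian_of_mem_laplacians hL) (p - 1) ^ (1 - (p⁻¹).toReal)) := by
  obtain ⟨V, hV⟩ := exists_isDiagonalization hL
  have hp1 : 1 ≤ p := by
    rw [← ENNReal.ofReal_toReal hp, ENNReal.one_le_ofReal]
    exact h1.le
  have hsub : (p - 1).toReal = p.toReal - 1 := by
    rw [ENNReal.toReal_sub_of_le hp1 hp, ENNReal.toReal_one]
  have hexp : 1 / (p.toReal - 1) * (1 - p.toReal⁻¹) = 1 / p.toReal := by
    have h2 : p.toReal - 1 ≠ 0 := by linarith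
    have h3 : p.toReal ≠ 0 := by linarith
    field_simp
  rw [networkNorm_of_ne_top hL hp h1, spectralZeta, if_neg (ENNReal.sub_ne_top hp), hsub,
    ENNReal.toReal_inv, ← Real.rpow_mul, hexp]
  exact Finset.sum_nonneg fun i _ => Real.rpow_nonneg (hV.pos i i.2).le _

theorem isSystemicPerformanceMeasure_of_ne_top {p : ℝ≥0∞} (hp : p ≠ ∞) (h1 : 1 < p.toReal) :
    IsSystemicPerformanceMeasure
      (fun L : Matrix (Fin n) (Fin n) ℝ => (networkNorm p L).toReal) := by
  have hα := alphaZero_nonneg hp h1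
  have hq : 0 ≤ p.toReal - 1 := by linarith
  have ht : 0 ≤ 1 / p.toReal := by positivity
  have hsum : ∀ {L : Matrix (Fin n) (Fin n) ℝ} (hL : L ∈ laplacians n),
      0 ≤ ∑ i : {i : Fin n // 0 < (i : ℕ)},
        eigenvalue (isHermitian_of_mem_laplacians hL) i ^ (-(p.toReal - 1)) := fun hL => by
    obtain ⟨V, hV⟩ := exists_isDiagonalization hL
    exact Finset.sum_nonneg fun i _ => Real.rpow_nonneg (hV.pos i i.2).le _
  have hval : ∀ {L : Matrix (Fin n) (Fin n) ℝ} (hL : L ∈ laplacians n),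
      (networkNorm p L).toReal = alphaZero p * (∑ i : {i : Fin n // 0 < (i : ℕ)},
        eigenvalue (isHermitian_of_mem_laplacians hL) i ^ (-(p.toReal - 1))) ^
          (1 / p.toReal) := fun hL => by
    rw [networkNorm_of_ne_top hL hp h1,
      ENNReal.toReal_ofReal (mul_nonneg hα (Real.rpow_nonneg (hsum hL) _))]
  refine ⟨fun L₁ h₁ L₂ h₂ hle => ?_, convexOn_iff_forall_pos.2 ⟨convex_laplacians, ?_⟩, ?_⟩
  · obtain ⟨V₁, hV₁⟩ := exists_isDiagonalization h₁
    obtain ⟨V₂, hV₂⟩ := exists_isDiagonalization h₂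
    simp only [hval h₁, hval h₂]
    exact mul_le_mul_of_nonneg_left (Real.rpow_le_rpow (hsum h₁)
      (hV₁.sum_rpow_neg_le_of_posSemidef hV₂ hle hq) ht) hα
  · intro L₁ h₁ L₂ h₂ a b ha hb hab
    have h := convex_laplacians h₁ h₂ ha.le hb.le hab
    obtain ⟨V₁, hV₁⟩ := exists_isDiagonalization h₁
    obtain ⟨V₂, hV₂⟩ := exists_isDiagonalization h₂
    obtain ⟨V, hV⟩ := exists_isDiagonalization h
    simp only [hval h₁, hval h₂, hval h, smul_eq_mul]
    refine (mul_le_mul_of_nonneg_left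
      (hV₁.sum_rpow_neg_convex hV₂ hV ha hb hab rfl hq ht) hα).trans_eq ?_
    ring
  · intro L hL U hU hL'
    simp only [hval hL, hval hL']
    rw [eigenvalue_eq_of_charpoly_eq (isHermitian_of_mem_laplacians hL)
      (isHermitian_of_mem_laplacians hL')]
    have hU' : Uᵀ * U = 1 := by
      have := Unitary.star_mul_self_of_mem hU
      rwa [Matrix.star_eq_conjTranspose, Matrix.conjTranspose_eq_transpose_of_trivial] at this
    rw [Matrix.charpoly_mul_comm, ← Matrix.mul_assoc, hU', Matrix.one_mul]

end FiniteOrder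

/-! ### Limits as the order tends to infinity, and the case `p = ∞`. -/

section InfiniteOrder

variable {n : ℕ}

/-- For large `r`, monotonicity of `Γ` on `[2, ∞)` and `Γ(x + 1) = x Γ(x)` put `Γ(r/2) / Γ((r-1)/2)`
between `1` and `r`, and the `r`-th roots of both bounds tend to `1`. -/
theorem tendsto_alphaZero :
    Tendsto (fun r : ℝ => alphaZero (ENNReal.ofReal r)) atTop (𝓝 (alphaZero ∞)) := by
  have hlim : Tendsto (fun r : ℝ => (-ProbabilityTheory.beta (r / 2) (-1 / 2)) ^ (1 / r)) atTop
      (𝓝 1) := by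
    have hc : 0 < 2 * √Real.pi := by positivity
    have hconst : Tendsto (fun r : ℝ => (2 * √Real.pi) ^ (1 / r)) atTop (𝓝 1) := by
      have h0 : Tendsto (fun r : ℝ => 1 / r) atTop (𝓝 0) := by
        simpa using tendsto_inv_atTop_zero (𝕜 := ℝ)
      simpa using (tendsto_const_nhds (x := 2 * √Real.pi)).rpow h0 (Or.inl hc.ne')
    have hupper : Tendsto (fun r : ℝ => (2 * √Real.pi) ^ (1 / r) * r ^ (1 / r)) atTop (𝓝 1) := by
      simpa using hconst.mul tendsto_rpow_div
    refine tendsto_of_tendsto_of_tendsto_of_le_of_le' hconst hupper ?_ ?_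
    all_goals
      -- The threshold `5` makes `(r - 1) / 2 ≥ 2`.
      filter_upwards [eventually_ge_atTop 5] with r hr
      have hx : 2 ≤ (r - 1) / 2 := by linarith
      have hΓ := Real.Gamma_pos_of_pos (show 0 < (r - 1) / 2 by linarith)
      have hmono := Real.Gamma_strictMonoOn_Ici.monotoneOn
      have ht : 0 ≤ 1 / r := by positivity
      rw [neg_beta_neg_half]
    · refine Real.rpow_le_rpow hc.le ?_ ht
      rw [le_div_iff₀ hΓ]
      exact mul_le_mul_of_nonneg_left
        (hmono hx (show 2 ≤ r / 2 by linarith) (by linarith)) hc.le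
    · rw [← Real.mul_rpow hc.le (by linarith)]
      refine Real.rpow_le_rpow ?_ ?_ ht
      · have := Real.Gamma_pos_of_pos (show 0 < r / 2 by linarith)
        positivity
      · rw [div_le_iff₀ hΓ, mul_assoc (2 * √Real.pi) r]
        refine mul_le_mul_of_nonneg_left ?_ hc.le
        calc Real.Gamma (r / 2) ≤ Real.Gamma ((r - 1) / 2 + 1) :=
              hmono (show 2 ≤ r / 2 by linarith) (show 2 ≤ (r - 1) / 2 + 1 by linarith)
                (by linarith)
          _ = (r - 1) / 2 * Real.Gamma ((r - 1) / 2) := Real.Gamma_add_one (by linarith)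
          _ ≤ _ := mul_le_mul_of_nonneg_right (by linarith) hΓ.le
  have h := hlim.inv₀ one_ne_zero
  rw [inv_one] at h
  rw [show alphaZero ∞ = 1 from if_pos rfl]
  refine h.congr' ?_
  filter_upwards [eventually_ge_atTop 0] with r hr
  rw [alphaZero_of_ne_top ENNReal.ofReal_ne_top, ENNReal.toReal_ofReal hr]

/-- The `ℓ^r` norm of finitely many positive numbers tends to their maximum. -/
theorem tendsto_sum_rpow_neg_rpow_one_div {ι : Type*} [Fintype ι] {a : ι → ℝ}
    (ha : ∀ i, 0 < a i) :
    Tendsto (fun r : ℝ => (∑ i, a i ^ (-r)) ^ (1 / r)) atTop (𝓝 (⨆ i, (a i)⁻¹)) := by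
  rcases isEmpty_or_nonempty ι with hι | hι
  -- The case of a single node: the empty supremum is `0`, and so is `0 ^ (1 / r)`.
  · rw [Real.iSup_of_isEmpty]
    refine tendsto_const_nhds.congr' ?_
    filter_upwards [eventually_gt_atTop 0] with r hr
    rw [Finset.univ_eq_empty, Finset.sum_empty, Real.zero_rpow (by positivity)]
  obtain ⟨i₀, hi₀⟩ := Finite.exists_max fun i => (a i)⁻¹
  have hm : ⨆ i, (a i)⁻¹ = (a i₀)⁻¹ :=
    le_antisymm (ciSup_le hi₀) (le_ciSup (f := fun i => (a i)⁻¹) (Set.finite_range _).bddAbove i₀)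
  rw [hm]
  have hm0 : 0 < (a i₀)⁻¹ := inv_pos.2 (ha i₀)
  have hpow : ∀ i (r : ℝ), a i ^ (-r) = (a i)⁻¹ ^ r := fun i r => by
    rw [Real.rpow_neg (ha i).le, Real.inv_rpow (ha i).le]
  have hroot : ∀ r : ℝ, 0 < r → ((a i₀)⁻¹ ^ r) ^ (1 / r) = (a i₀)⁻¹ := fun r hr => by
    rw [← Real.rpow_mul hm0.le, mul_one_div_cancel hr.ne', Real.rpow_one]
  have hcard : (0 : ℝ) < Fintype.card ι := by exact_mod_cast Fintype.card_pos
  have hupper : Tendsto (fun r : ℝ => (Fintype.card ι : ℝ) ^ (1 / r) * (a i₀)⁻¹) atTop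
      (𝓝 (a i₀)⁻¹) := by
    have h0 : Tendsto (fun r : ℝ => 1 / r) atTop (𝓝 0) := by
      simpa using tendsto_inv_atTop_zero (𝕜 := ℝ)
    simpa using ((tendsto_const_nhds (x := (Fintype.card ι : ℝ))).rpow h0
      (Or.inl hcard.ne')).mul_const (a i₀)⁻¹
  -- The sum lies between its largest term and the number of terms times it.
  refine tendsto_of_tendsto_of_tendsto_of_le_of_le' tendsto_const_nhds hupper ?_ ?_
  all_goals
    filter_upwards [eventually_gt_atTop 0] with r hr
    have ht : 0 ≤ 1 / r := by positivity
    simp only [hpow]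
  · conv_lhs => rw [← hroot r hr]
    refine Real.rpow_le_rpow (Real.rpow_nonneg hm0.le _) ?_ ht
    exact Finset.single_le_sum (f := fun i => (a i)⁻¹ ^ r)
      (fun i _ => Real.rpow_nonneg (inv_pos.2 (ha i)).le _) (Finset.mem_univ i₀)
  · conv_rhs => rw [← hroot r hr]
    rw [← Real.mul_rpow hcard.le (Real.rpow_nonneg hm0.le _)]
    refine Real.rpow_le_rpow (Finset.sum_nonneg fun i _ =>
      Real.rpow_nonneg (inv_pos.2 (ha i)).le _) ?_ ht
    rw [← nsmul_eq_mul]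
    exact Finset.sum_le_card_nsmul _ _ _ fun i _ =>
      Real.rpow_le_rpow (inv_pos.2 (ha i)).le (hi₀ i) hr.le

theorem tendsto_spectralZeta {L : Matrix (Fin n) (Fin n) ℝ} (hL : L ∈ laplacians n) :
    Tendsto (fun r : ℝ => spectralZeta (isHermitian_of_mem_laplacians hL) (ENNReal.ofReal r)) atTop
      (𝓝 (spectralZeta (isHermitian_of_mem_laplacians hL) ∞)) := by
  obtain ⟨V, hV⟩ := exists_isDiagonalization hL
  rw [spectralZeta, if_pos rfl]
  refine (tendsto_sum_rpow_neg_rpow_one_div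
    fun i : {i : Fin n // 0 < (i : ℕ)} => hV.pos i i.2).congr' ?_
  filter_upwards [eventually_ge_atTop 0] with r hr
  rw [spectralZeta, if_neg ENNReal.ofReal_ne_top, ENNReal.toReal_ofReal hr]

theorem networkNorm_top {L : Matrix (Fin n) (Fin n) ℝ} (hL : L ∈ laplacians n) :
    networkNorm ∞ L =
      ENNReal.ofReal (spectralZeta (isHermitian_of_mem_laplacians hL) ∞) := by
  obtain ⟨V, hV⟩ := exists_isDiagonalization hL
  set d := eigenvalue (isHermitian_of_mem_laplacians hL) with hd
  have hn : 0 < n := by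
    obtain ⟨K, hK, -⟩ := hL
    exact Fin.pos_iff_nonempty.2 hK.connected.nonempty
  set m : ℝ := ⨆ i : {i : Fin n // 0 < (i : ℕ)}, (d i)⁻¹ with hm
  have hle : ∀ i : {i : Fin n // 0 < (i : ℕ)}, (d i)⁻¹ ≤ m := fun i =>
    le_ciSup (f := fun i : {i : Fin n // 0 < (i : ℕ)} => (d i)⁻¹) (Set.finite_range _).bddAbove i
  have hm0 : 0 ≤ m := Real.iSup_nonneg fun i => (inv_pos.2 (hV.pos i i.2)).le
  rw [networkNorm, hardySchattenNorm, if_pos rfl, spectralZeta, if_pos rfl]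
  set f : ℝ → ℝ≥0∞ := fun ω => ENNReal.ofReal
    (singularValue (transferMatrix (-L) 1 (centering n) (Complex.I * ω)) 0) with hf
  refine le_antisymm (essSup_le_of_ae_le _ ?_) ?_
  · filter_upwards [Measure.ae_ne volume (0 : ℝ)] with ω hω
    obtain ⟨hU, hG⟩ := hV.transferMatrix_eq fun i => I_mul_add_ofReal_ne_zero hω (d i)
    obtain ⟨i, hi⟩ := exists_singularValue_zero_eq hU hG hn
    refine ENNReal.ofReal_le_ofReal ?_
    rw [hi]
    rcases Nat.eq_zero_or_pos (i : ℕ) with h0 | hpos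
    · simpa [transferEigenvalue, h0] using hm0
    · rw [norm_transferEigenvalue_of_pos hpos]
      refine le_trans ?_ (hle ⟨i, hpos⟩)
      refine inv_anti₀ (hV.pos i hpos) (Real.le_sqrt_of_sq_le ?_)
      linarith [sq_nonneg ω]
  · have hbound : ∀ i : {i : Fin n // 0 < (i : ℕ)},
        ENNReal.ofReal (d i)⁻¹ ≤ essSup f volume := fun i => by
      have hdi := hV.pos i i.2
      have hae : ∀ᵐ ω : ℝ, ENNReal.ofReal (√(d i ^ 2 + ω ^ 2))⁻¹ ≤ essSup f volume := by
        filter_upwards [Measure.ae_ne volume (0 : ℝ), ENNReal.ae_le_essSup f] with ω hω hfω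
        obtain ⟨hU, hG⟩ := hV.transferMatrix_eq fun i => I_mul_add_ofReal_ne_zero hω (d i)
        refine le_trans (ENNReal.ofReal_le_ofReal ?_) hfω
        rw [← norm_transferEigenvalue_of_pos i.2]
        exact norm_le_singularValue_zero hU hG i
      -- The value `λ_i⁻¹` belongs to the excluded frequency `ω = 0`. The bound holds almost
      -- everywhere, hence on a dense set, and continuity extends it to `0`.
      have hcont : Continuous fun ω : ℝ => ENNReal.ofReal (√(d i ^ 2 + ω ^ 2))⁻¹ := by
        refine ENNReal.continuous_ofReal.comp (Continuous.inv₀ (by fun_prop) fun ω => ?_)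
        exact (Real.sqrt_pos.2 (by positivity)).ne'
      have hall := (isClosed_le hcont continuous_const).closure_eq ▸
        (Measure.dense_of_ae hae).closure_eq
      have h0 : (0 : ℝ) ∈ {ω : ℝ | ENNReal.ofReal (√(d i ^ 2 + ω ^ 2))⁻¹ ≤ essSup f volume} :=
        hall ▸ Set.mem_univ _
      simpa [Real.sqrt_sq hdi.le] using h0
    rcases isEmpty_or_nonempty {i : Fin n // 0 < (i : ℕ)} with hι | hι
    · rw [Real.iSup_of_isEmpty, ENNReal.ofReal_zero]
      exact zero_le
    · obtain ⟨i₀, hi₀⟩ := Finite.exists_max fun i : {i : Fin n // 0 < (i : ℕ)} => (d i)⁻¹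
      exact (ENNReal.ofReal_le_ofReal (ciSup_le hi₀)).trans (hbound i₀)

theorem networkNorm_eq_spectralZeta {L : Matrix (Fin n) (Fin n) ℝ} (hL : L ∈ laplacians n)
    {p : ℝ≥0∞} (hp : 2 ≤ p) :
    networkNorm p L = ENNReal.ofReal (alphaZero p *
      spectralZeta (isHermitian_of_mem_laplacians hL) (p - 1) ^ (1 - (p⁻¹).toReal)) := by
  rcases eq_or_ne p ∞ with rfl | hp'
  · rw [networkNorm_top hL, show alphaZero ∞ = 1 from if_pos rfl]
    simp
  · refine networkNorm_eq_spectralZeta_of_ne_top hL hp' ?_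
    have := ENNReal.toReal_mono hp' hp
    rw [ENNReal.toReal_ofNat] at this
    linarith

theorem tendsto_networkNorm {L : Matrix (Fin n) (Fin n) ℝ} (hL : L ∈ laplacians n) :
    Tendsto (fun r : ℝ => networkNorm (ENNReal.ofReal r) L) atTop (𝓝 (networkNorm ∞ L)) := by
  have hζ := (tendsto_spectralZeta hL).comp
    (tendsto_atTop_add_const_right atTop (-1 : ℝ) tendsto_id)
  have hexp : Tendsto (fun r : ℝ => 1 - r⁻¹) atTop (𝓝 (1 - 0)) :=
    tendsto_const_nhds.sub tendsto_inv_atTop_zero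
  -- The limit exponent `1` is positive, so the power is continuous even when the limit base is `0`,
  -- as for a single node.
  have h := ENNReal.tendsto_ofReal
    (tendsto_alphaZero.mul (hζ.rpow hexp (Or.inr (by norm_num))))
  have hval : networkNorm ∞ L = ENNReal.ofReal (alphaZero ∞ *
      spectralZeta (isHermitian_of_mem_laplacians hL) ∞ ^ (1 - 0 : ℝ)) := by
    rw [networkNorm_top hL, show alphaZero ∞ = 1 from if_pos rfl]
    simp
  rw [hval]
  refine h.congr' ?_
  filter_upwards [eventually_ge_atTop 2] with r hr
  have hr0 : 0 ≤ r := by linarith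
  rw [networkNorm_eq_spectralZeta hL (by simpa using ENNReal.ofReal_le_ofReal hr),
    ENNReal.toReal_inv, ENNReal.toReal_ofReal hr0, ← ENNReal.ofReal_one,
    ← ENNReal.ofReal_sub _ zero_le_one]
  rfl

/-- All three properties are non-strict inequalities or equalities between finitely many values, so
they survive pointwise limits. -/
theorem IsSystemicPerformanceMeasure.of_tendsto {ι : Type*} {l : Filter ι} [l.NeBot]
    {ρ : ι → Matrix (Fin n) (Fin n) ℝ → ℝ} {ρ' : Matrix (Fin n) (Fin n) ℝ → ℝ}
    (hρ : ∀ᶠ r in l, IsSystemicPerformanceMeasure (ρ r))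
    (hlim : ∀ L ∈ laplacians n, Tendsto (fun r => ρ r L) l (𝓝 (ρ' L))) :
    IsSystemicPerformanceMeasure ρ' where
  monotone L₁ h₁ L₂ h₂ hle := le_of_tendsto_of_tendsto (hlim L₁ h₁) (hlim L₂ h₂)
    (hρ.mono fun _ h => h.monotone L₁ h₁ L₂ h₂ hle)
  convex := ⟨convex_laplacians, fun L₁ h₁ L₂ h₂ _ _ ha hb hab =>
    le_of_tendsto_of_tendsto (hlim _ (convex_laplacians h₁ h₂ ha hb hab))
      (((hlim L₁ h₁).const_smul _).add ((hlim L₂ h₂).const_smul _))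
      (hρ.mono fun _ h => h.convex.2 h₁ h₂ ha hb hab)⟩
  orthogonal_invariant L hL U hU hL' := tendsto_nhds_unique_of_eventuallyEq (hlim L hL)
    (hlim _ hL') (hρ.mono fun _ h => h.orthogonal_invariant L hL U hU hL')

theorem isSystemicPerformanceMeasure_networkNorm {p : ℝ≥0∞} (hp : 2 ≤ p) :
    IsSystemicPerformanceMeasure
      (fun L : Matrix (Fin n) (Fin n) ℝ => (networkNorm p L).toReal) := by
  rcases eq_or_ne p ∞ with rfl | hp'
  · refine IsSystemicPerformanceMeasure.of_tendsto (l := (atTop : Filter ℝ))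
      (ρ := fun r L => (networkNorm (ENNReal.ofReal r) L).toReal) ?_ fun L hL => ?_
    · filter_upwards [eventually_gt_atTop 1] with r hr
      exact isSystemicPerformanceMeasure_of_ne_top ENNReal.ofReal_ne_top
        (by rwa [ENNReal.toReal_ofReal (by linarith)])
    · refine (ENNReal.tendsto_toReal ?_).comp (tendsto_networkNorm hL)
      rw [networkNorm_top hL]
      exact ENNReal.ofReal_ne_top
  · refine isSystemicPerformanceMeasure_of_ne_top hp' ?_
    have := ENNReal.toReal_mono hp' hp
    rw [ENNReal.toReal_ofNat] at this
    linarith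

end InfiniteOrder

end ConsensusNetwork

theorem mainTheorem12 (n : ℕ) (p : ℝ≥0∞) (hp : 2 ≤ p) :
    ConsensusNetwork.IsSystemicPerformanceMeasure
      (fun L : Matrix (Fin n) (Fin n) ℝ => (ConsensusNetwork.networkNorm p L).toReal) ∧
    (∀ (L : Matrix (Fin n) (Fin n) ℝ) (hL : L ∈ ConsensusNetwork.laplacians n),
      ConsensusNetwork.networkNorm p L = ENNReal.ofReal (ConsensusNetwork.alphaZero p *
        ConsensusNetwork.spectralZeta (ConsensusNetwork.isHermitian_of_mem_laplacians hL) (p - 1) ^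
          (1 - (p⁻¹).toReal))) ∧
    -- the three quantities at infinite order are the limits of those at finite order
    Tendsto (fun r : ℝ => ConsensusNetwork.alphaZero (ENNReal.ofReal r)) atTop
      (𝓝 (ConsensusNetwork.alphaZero ∞)) ∧
    (∀ (L : Matrix (Fin n) (Fin n) ℝ) (hL : L ∈ ConsensusNetwork.laplacians n),
      Tendsto (fun r : ℝ => ConsensusNetwork.spectralZeta
          (ConsensusNetwork.isHermitian_of_mem_laplacians hL) (ENNReal.ofReal r)) atTop
        (𝓝 (ConsensusNetwork.spectralZeta
          (ConsensusNetwork.isHermitian_of_mem_laplacians hL) ∞)) ∧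
      Tendsto (fun r : ℝ => ConsensusNetwork.networkNorm (ENNReal.ofReal r) L) atTop
        (𝓝 (ConsensusNetwork.networkNorm ∞ L))) := by
  exact ⟨ConsensusNetwork.isSystemicPerformanceMeasure_networkNorm hp,
    fun _ hL => ConsensusNetwork.networkNorm_eq_spectralZeta hL hp,
    ConsensusNetwork.tendsto_alphaZero,
    fun _ hL => ⟨ConsensusNetwork.tendsto_spectralZeta hL,
      ConsensusNetwork.tendsto_networkNorm hL⟩⟩
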